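/- Let $X$ be a standard Borel space and let $\mathcal R$ be a Borel equivalence relation on $X$ all of whose classes are countable. A *treeing* of $\mathcal R$ is a Borel set $G \subseteq X\times X$ that is symmetric, disjoint from the diagonal and contained in $\mathcal R$, and such that for every $\mathcal R$-class $C$ the graph with vertex set $C$ and edge set $G\cap (C\times C)$ is a tree (connected and without cycles); $\mathcal R$ is *treeable* if it admits a treeing. Suppose that $\mathcal R$ is treeable. Then every Borel equivalence relation $\mathcal S$ on $X$ with $\mathcal S\subseteq\mathcal R$ is treeable. More generally, if $A\subseteq X$ is a Borel subset and $\mathcal S$ is a Borel equivalence relation on $A$ with $\mathcal S\subseteq\mathcal R$, then $\mathcal S$ is treeable (as an equivalence relation on the standard Borel space $A$). -/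

import Mathlib

/-- The equivalence relation `R` is Borel: its graph is a measurable subset of `X × X`. -/
def IsBorelRel {X : Type*} [MeasurableSpace X] (R : Setoid X) : Prop :=
  MeasurableSet {p : X × X | R p.1 p.2}

/-- `R` is a countable Borel equivalence relation: it is Borel and its classes are countable. -/
structure IsCountableBorelRel {X : Type*} [MeasurableSpace X] (R : Setoid X) : Prop where
  borel : IsBorelRel R
  countable_class : ∀ x : X, {y : X | R x y}.Countable

/-- `G` is a treeing of `R`: a Borel graph on `X` (symmetric and disjoint from the diagonal)
that is contained in `R` and whose restriction to each `R`-class is a tree, in particular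
connected. -/
structure IsTreeing {X : Type*} [MeasurableSpace X] (R : Setoid X) (G : SimpleGraph X) :
    Prop where
  borel : MeasurableSet {p : X × X | G.Adj p.1 p.2}
  adj_rel : ∀ x y : X, G.Adj x y → R x y
  isTree : ∀ x : X, (G.induce {y : X | R x y}).IsTree

/-- `R` is treeable: it admits a treeing. -/
def IsTreeable {X : Type*} [MeasurableSpace X] (R : Setoid X) : Prop :=
  ∃ G : SimpleGraph X, IsTreeing R G

/-!
Let `G` be a treeing of `R` and let `C` be a class of the subrelation. Every vertex from which `C`
can be reached walks to `C`, at each step moving to a neighbor closer to `C`. The vertices that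
arrive at the same point of `C` span a connected subgraph of `G`, and contracting these subgraphs
turns the acyclic graph `G` into an acyclic graph, which is connected on `C`. The contraction is
Borel because the neighbors of a vertex can be enumerated by countably many Borel maps, so that each
vertex moves to the first neighbor in the enumeration that is closer to `C`.

The enumeration is the Lusin–Novikov theorem for `R`. It says that the domain of a countable-to-one
Borel map is a countable union of Borel sets on which the map is injective. The sets covered in this
way form a σ-ideal. Outside of it, one builds by successive halving a sequence of points lying in
one fiber and having a closure without isolated points, and that fiber is therefore uncountable.
-/

open Set MeasureTheory Topology Filter

section SigmaInjective

variable {Z X : Type*} {f : Z → X}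

/-- The sequences `z` inside a single fiber of `f` with `z j ∈ U j` for all `j`. -/
def fiberSequences (f : Z → X) (U : ℕ → Set Z) : Set (ℕ → Z) :=
  {z | (∀ j, z j ∈ U j) ∧ ∀ j k, f (z j) = f (z k)}

theorem fiberSequences_mono {U V : ℕ → Set Z} (h : ∀ j, U j ⊆ V j) :
    fiberSequences f U ⊆ fiberSequences f V :=
  fun _ hz => ⟨fun j => h j (hz.1 j), hz.2⟩

open Function in
theorem update_mem_fiberSequences {i m : ℕ} {U : ℕ → Set Z} {B B' W : Set Z} {z : ℕ → Z} {y : Z}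
    (hz : z ∈ fiberSequences f fun j => U j \ W) (hzB : z i ∈ B) (hy : y ∈ B' \ W)
    (hfy : f y = f (z i)) :
    update z m y ∈ fiberSequences f fun j => update (update U i B) m B' j \ W := by
  have hf (j : ℕ) : f (update z m y j) = f (z i) := by
    rcases eq_or_ne j m with rfl | hjm
    · rwa [update_self]
    · rw [update_of_ne hjm, hz.2 j i]
  refine ⟨fun j => ?_, fun j k => (hf j).trans (hf k).symm⟩
  rcases eq_or_ne j m with rfl | hjm
  · simpa only [update_self] using hy
  rcases eq_or_ne j i with rfl | hji
  · simpa only [update_self, update_of_ne hjm] using ⟨hzB, (hz.1 j).2⟩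
  · simpa only [update_of_ne hjm, update_of_ne hji] using hz.1 j

variable [MeasurableSpace Z]

/-- `W` is a countable union of measurable sets on each of which `f` is injective. These sets form
the `σ`-ideal with respect to which the proof of the Lusin–Novikov theorem works. -/
def IsSigmaInjective (f : Z → X) (W : Set Z) : Prop :=
  ∃ B : ℕ → Set Z, (∀ n, MeasurableSet (B n)) ∧ (∀ n, InjOn f (B n)) ∧ ⋃ n, B n = W

/-- After removal of a `σ`-injective set, no fiber of `f` meets all the sets `U j`. -/
def IsNegligible (f : Z → X) (U : ℕ → Set Z) : Prop :=
  ∃ W, IsSigmaInjective f W ∧ fiberSequences f (fun j => U j \ W) = ∅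

theorem IsSigmaInjective.measurableSet {W : Set Z} (hW : IsSigmaInjective f W) :
    MeasurableSet W := by
  obtain ⟨B, hB, -, rfl⟩ := hW
  exact MeasurableSet.iUnion hB

theorem isSigmaInjective_of_injOn {W : Set Z} (hW : MeasurableSet W) (h : InjOn f W) :
    IsSigmaInjective f W :=
  ⟨fun _ => W, fun _ => hW, fun _ => h, iUnion_const W⟩

theorem isSigmaInjective_empty : IsSigmaInjective f ∅ :=
  isSigmaInjective_of_injOn .empty (injOn_empty f)

theorem IsSigmaInjective.iUnion {ι : Type*} [Countable ι] {W : ι → Set Z}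
    (hW : ∀ i, IsSigmaInjective f (W i)) : IsSigmaInjective f (⋃ i, W i) := by
  cases isEmpty_or_nonempty ι
  · rw [iUnion_of_empty]
    exact isSigmaInjective_empty
  choose B hBm hBinj hBW using hW
  obtain ⟨e, he⟩ := exists_surjective_nat (ι × ℕ)
  refine ⟨fun n => B (e n).1 (e n).2, fun _ => hBm _ _, fun _ => hBinj _ _, ?_⟩
  rw [he.iUnion_comp (fun p : ι × ℕ => B p.1 p.2), iUnion_prod']
  exact iUnion_congr hBW

theorem IsSigmaInjective.union {V W : Set Z} (hV : IsSigmaInjective f V)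
    (hW : IsSigmaInjective f W) : IsSigmaInjective f (V ∪ W) := by
  rw [union_eq_iUnion]
  exact .iUnion fun b => by cases b <;> assumption

theorem isNegligible_of_fiberSequences_eq_empty {U : ℕ → Set Z} (h : fiberSequences f U = ∅) :
    IsNegligible f U :=
  ⟨∅, isSigmaInjective_empty, by simpa only [sdiff_empty] using h⟩

theorem isSigmaInjective_univ_of_isNegligible (h : IsNegligible f fun _ => univ) :
    IsSigmaInjective f univ := by
  obtain ⟨W, hW, hempty⟩ := h
  suffices W = univ from this ▸ hW
  refine eq_univ_of_forall fun z => by_contra fun hz => ?_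
  exact (hempty.subset ⟨fun _ => ⟨mem_univ z, hz⟩, fun _ _ => rfl⟩ : (fun _ => z) ∈ (∅ : Set _))

theorem measurableSet_fiberSequences [MeasurableSpace X] [MeasurableEq X] (hf : Measurable f)
    {U : ℕ → Set Z} (hU : ∀ j, MeasurableSet (U j)) : MeasurableSet (fiberSequences f U) := by
  simp only [fiberSequences, ofPred_and, ofPred_forall]
  refine .inter (.iInter fun j => measurable_pi_apply j (hU j)) ?_
  exact .iInter fun j => .iInter fun k =>
    measurableSet_eq_fun (hf.comp (measurable_pi_apply j)) (hf.comp (measurable_pi_apply k))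

end SigmaInjective

section Separation

variable {Z X : Type*} [TopologicalSpace Z] [PolishSpace Z] [MeasurableSpace Z] [BorelSpace Z]
  [MeasurableSpace X] [MeasurableEq X] {f : Z → X} {A : Set Z}

theorem analyticSet_setOf_exists_mem_fiber_ne (hf : Measurable f) (hA : AnalyticSet A) :
    AnalyticSet {z | ∃ a ∈ A, f a = f z ∧ a ≠ z} := by
  have hpairs : AnalyticSet {p : Z × Z | f p.1 = f p.2 ∧ p.1 ≠ p.2} :=
    ((measurableSet_eq_fun (hf.comp measurable_fst) (hf.comp measurable_snd)).inter
      (measurableSet_eq_fun measurable_fst measurable_snd).compl).analyticSet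
  have hinter : AnalyticSet (Prod.fst ⁻¹' A ∩ {p : Z × Z | f p.1 = f p.2 ∧ p.1 ≠ p.2}) := by
    rw [inter_eq_iInter]
    exact .iInter fun b => by
      cases b
      · exact hpairs
      · exact hA.preimage continuous_fst
  convert hinter.image_of_continuous continuous_snd using 1
  ext z
  simp

/-- One separation yields a measurable `B ⊇ A` such that no point of `A` shares its fiber with
another point of `B`; a second one discards the points of `B` sharing their fiber with another
point of `B`. -/
theorem exists_measurableSet_injOn_superset (hf : Measurable f)
    (hA : AnalyticSet A) (hinj : InjOn f A) : ∃ B, A ⊆ B ∧ MeasurableSet B ∧ InjOn f B := by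
  obtain ⟨B, hAB, hdisj, hB⟩ := hA.measurablySeparable
    (analyticSet_setOf_exists_mem_fiber_ne hf hA) (by
      rw [Set.disjoint_left]
      rintro z hz ⟨a, ha, hfa, hne⟩
      exact hne (hinj ha hz hfa))
  obtain ⟨B', hAB', hdisj', hB'⟩ := hA.measurablySeparable
    (analyticSet_setOf_exists_mem_fiber_ne hf hB.analyticSet) (by
      rw [Set.disjoint_left]
      rintro a ha ⟨b, hb, hfb, hne⟩
      exact Set.disjoint_left.1 hdisj ⟨a, ha, hfb.symm, hne.symm⟩ hb)
  refine ⟨B ∩ B', subset_inter hAB hAB', hB.inter hB', fun x hx y hy hxy => ?_⟩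
  by_contra hne
  exact Set.disjoint_left.1 hdisj' ⟨x, hx.1, hxy, hne⟩ hy.2

end Separation

section Splitting

variable {Z X : Type*} [MetricSpace Z]

/-- `V` arises from `U` by shrinking `U i` to `V i` and by replacing `U m` with a second subset
`V m` of `U i`, disjoint from `V i`. -/
structure IsSplitting (i m : ℕ) (ε : ℝ) (U V : ℕ → Set Z) : Prop where
  subset : ∀ j, j ≠ m → V j ⊆ U j
  closure_subset : closure (V i) ⊆ U i
  closure_new_subset : closure (V m) ⊆ U i
  disjoint : Disjoint (V i) (V m)
  dist_le : ∀ x ∈ V i, ∀ y ∈ V i, dist x y ≤ ε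

theorem exists_mem_countableBasis_closure_subset [SecondCountableTopology Z] {O : Set Z}
    (hO : IsOpen O) {x : Z} (hx : x ∈ O) {ε : ℝ} (hε : 0 < ε) :
    ∃ B ∈ TopologicalSpace.countableBasis Z, x ∈ B ∧ closure B ⊆ O ∧
      ∀ y ∈ B, ∀ z ∈ B, dist y z ≤ ε := by
  obtain ⟨r, hr, hrO⟩ := Metric.nhds_basis_closedBall.mem_iff.1 (hO.mem_nhds hx)
  obtain ⟨B, hB, hxB, hBball⟩ :=
    (TopologicalSpace.isBasis_countableBasis Z).exists_subset_of_mem_open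
      (Metric.mem_ball_self (x := x) (lt_min hr (half_pos hε))) Metric.isOpen_ball
  refine ⟨B, hB, hxB, ?_, fun y hy z hz => ?_⟩
  · exact (closure_mono hBball).trans <| Metric.closure_ball_subset_closedBall.trans <|
      (Metric.closedBall_subset_closedBall (min_le_left _ _)).trans hrO
  · have hy' := Metric.mem_ball.1 (hBball hy)
    have hz' := Metric.mem_ball.1 (hBball hz)
    linarith [min_le_right r (ε / 2), dist_triangle_right y z x]

theorem exists_mem_countableBasis_disjoint [SecondCountableTopology Z] {O : Set Z}
    (hO : IsOpen O) {x y : Z} (hx : x ∈ O) (hy : y ∈ O) (hxy : x ≠ y) {ε : ℝ} (hε : 0 < ε) :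
    ∃ B ∈ TopologicalSpace.countableBasis Z, ∃ B' ∈ TopologicalSpace.countableBasis Z,
      x ∈ B ∧ y ∈ B' ∧ closure B ⊆ O ∧ closure B' ⊆ O ∧ Disjoint B B' ∧
      ∀ u ∈ B, ∀ v ∈ B, dist u v ≤ ε := by
  obtain ⟨N, N', hN, hN', hxN, hyN', hdisj⟩ := t2_separation hxy
  obtain ⟨B, hB, hxB, hBN, hdist⟩ :=
    exists_mem_countableBasis_closure_subset (hO.inter hN) ⟨hx, hxN⟩ hε
  obtain ⟨B', hB', hyB', hBN', -⟩ :=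
    exists_mem_countableBasis_closure_subset (hO.inter hN') ⟨hy, hyN'⟩ hε
  rw [subset_inter_iff] at hBN hBN'
  exact ⟨B, hB, B', hB', hxB, hyB', hBN.1, hBN'.1,
    hdisj.mono (subset_closure.trans hBN.2) (subset_closure.trans hBN'.2), hdist⟩

open Function in
theorem isSplitting_update {i m : ℕ} (him : i ≠ m) {U : ℕ → Set Z} {B B' : Set Z} {ε : ℝ}
    (hB : closure B ⊆ U i) (hB' : closure B' ⊆ U i) (hdisj : Disjoint B B')
    (hdist : ∀ x ∈ B, ∀ y ∈ B, dist x y ≤ ε) :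
    IsSplitting i m ε U (update (update U i B) m B') where
  subset j hj := by
    rcases eq_or_ne j i with rfl | hji
    · simpa only [update_of_ne hj, update_self] using subset_closure.trans hB
    · simp only [update_of_ne hj, update_of_ne hji, subset_rfl]
  closure_subset := by simpa only [update_of_ne him, update_self] using hB
  closure_new_subset := by simpa only [update_self] using hB'
  disjoint := by simpa only [update_of_ne him, update_self] using hdisj
  dist_le := by simpa only [update_of_ne him, update_self] using hdist

open Function in
theorem injOn_eval_image_fiberSequences [SecondCountableTopology Z] {f : Z → X} {i m : ℕ}
    (him : i ≠ m) {U : ℕ → Set Z} (hU : IsOpen (U i)) {ε : ℝ} (hε : 0 < ε) {W : Set Z}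
    (hW : ∀ B ∈ TopologicalSpace.countableBasis Z, ∀ B' ∈ TopologicalSpace.countableBasis Z,
      IsSplitting i m ε U (update (update U i B) m B') →
        fiberSequences f (fun j => update (update U i B) m B' j \ W) = ∅) :
    InjOn f (eval i '' fiberSequences f fun j => U j \ W) := by
  rintro _ ⟨z, hz, rfl⟩ _ ⟨z', hz', rfl⟩ hzz'
  by_contra hne
  obtain ⟨B, hB, B', hB', hzB, hzB', hBU, hBU', hdisj, hdist⟩ :=
    exists_mem_countableBasis_disjoint hU (hz.1 i).1 (hz'.1 i).1 hne hε
  have hmem := update_mem_fiberSequences (m := m) hz hzB ⟨hzB', (hz'.1 i).2⟩ hzz'.symm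
  rw [hW B hB B' hB' (isSplitting_update him hBU hBU' hdisj hdist)] at hmem
  exact hmem

variable [SecondCountableTopology Z] [CompleteSpace Z] [MeasurableSpace Z] [BorelSpace Z]
  {f : Z → X}

open Function in
/-- If all splittings along basic open sets were negligible, removing countably many `σ`-injective
sets would leave only sequences whose `i`-th term is determined by its fiber. -/
theorem exists_isSplitting_not_isNegligible [MeasurableSpace X] [MeasurableEq X]
    (hf : Measurable f) {i m : ℕ} (him : i ≠ m) {U : ℕ → Set Z} (hU : ∀ j, IsOpen (U j))
    (hlarge : ¬ IsNegligible f U) {ε : ℝ} (hε : 0 < ε) :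
    ∃ V : ℕ → Set Z, (∀ j, IsOpen (V j)) ∧ ¬ IsNegligible f V ∧ IsSplitting i m ε U V := by
  by_contra! hcon
  let b := TopologicalSpace.countableBasis Z
  have : Countable b := (TopologicalSpace.countable_countableBasis Z).to_subtype
  let split (c : b × b) : ℕ → Set Z := update (update U i c.1) m c.2
  have hopen (c : b × b) (j : ℕ) : IsOpen (split c j) := by
    have hbasis (B : b) : IsOpen (B : Set Z) := TopologicalSpace.isOpen_of_mem_countableBasis B.2
    simp only [split, update_apply]
    split_ifs
    exacts [hbasis _, hbasis _, hU j]
  have hnegl (c : {c // IsSplitting i m ε U (split c)}) : IsNegligible f (split c) :=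
    by_contra fun h => hcon _ (hopen c) h c.2
  choose W hW hWempty using hnegl
  have hWU : IsSigmaInjective f (⋃ c, W c) := .iUnion hW
  have hinj : InjOn f (eval i '' fiberSequences f fun j => U j \ ⋃ c, W c) :=
    injOn_eval_image_fiberSequences him (hU i) hε fun B hB B' hB' hsplit => by
      let c : {c // IsSplitting i m ε U (split c)} := ⟨(⟨B, hB⟩, ⟨B', hB'⟩), hsplit⟩
      exact subset_eq_empty (fiberSequences_mono fun j =>
        sdiff_subset_sdiff_right (subset_iUnion W c)) (hWempty c)
  have hmeas : MeasurableSet (fiberSequences f fun j => U j \ ⋃ c, W c) :=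
    measurableSet_fiberSequences hf fun j => (hU j).measurableSet.diff hWU.measurableSet
  obtain ⟨B, hDB, hB, hBinj⟩ := exists_measurableSet_injOn_superset hf
    (hmeas.analyticSet_image (measurable_pi_apply i)) hinj
  refine hlarge ⟨(⋃ c, W c) ∪ B, hWU.union (isSigmaInjective_of_injOn hB hBinj),
    eq_empty_of_forall_notMem fun z hz => (hz.1 i).2 (Or.inr (hDB (mem_image_of_mem _ ?_)))⟩
  exact fiberSequences_mono (fun _ => sdiff_subset_sdiff_right subset_union_left) hz

end Splitting

section SplittingScheme

variable {Z : Type*} [MetricSpace Z] {U : ℕ → ℕ → Set Z}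

/-- At time `k` the `k.unpair.1`-th open set splits and the set with index `k + 1` is born. Since
`k.unpair.1` takes every value infinitely often, every index splits infinitely often. -/
def IsSplittingScheme (U : ℕ → ℕ → Set Z) : Prop :=
  ∀ k, IsSplitting k.unpair.1 (k + 1) ((1 / 2) ^ k) (U k) (U (k + 1))

theorem IsSplittingScheme.subset (hU : IsSplittingScheme U) {j k l : ℕ} (hjk : j ≤ k)
    (hkl : k ≤ l) : U l j ⊆ U k j := by
  induction l, hkl using Nat.le_induction with
  | base => exact subset_rfl
  | succ l hkl ih => exact ((hU l).subset j (by omega)).trans ih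

theorem exists_ge_unpair_fst_eq (j k : ℕ) : ∃ l, j ≤ l ∧ k ≤ l ∧ l.unpair.1 = j :=
  ⟨Nat.pair j k, Nat.left_le_pair j k, Nat.right_le_pair j k, by rw [Nat.unpair_pair]⟩

theorem IsSplittingScheme.exists_closure_subset_dist_lt (hU : IsSplittingScheme U) {j k : ℕ}
    (hjk : j ≤ k) {ε : ℝ} (hε : 0 < ε) :
    ∃ l ≥ k, closure (U l j) ⊆ U k j ∧ ∀ x ∈ U l j, ∀ y ∈ U l j, dist x y < ε := by
  obtain ⟨n, hn⟩ := exists_pow_lt_of_lt_one hε one_half_lt_one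
  obtain ⟨l, hjl, hl, rfl⟩ := exists_ge_unpair_fst_eq j (max k n)
  rw [max_le_iff] at hl
  refine ⟨l + 1, by omega, (hU l).closure_subset.trans (hU.subset hjk hl.1), fun x hx y hy => ?_⟩
  exact ((hU l).dist_le x hx y hy).trans_lt <|
    (pow_le_pow_of_le_one (by norm_num) (by norm_num) hl.2).trans_lt hn

theorem IsSplittingScheme.exists_tendsto_mem [CompleteSpace Z] (hU : IsSplittingScheme U)
    {w : ℕ → Z} {j : ℕ} (hw : ∀ k, w k ∈ U k j) :
    ∃ x, Tendsto w atTop (𝓝 x) ∧ ∀ k ≥ j, x ∈ U k j := by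
  have hcauchy : CauchySeq w := Metric.cauchySeq_iff.2 fun ε hε => by
    obtain ⟨l, hl, -, hdist⟩ := hU.exists_closure_subset_dist_lt (le_refl j) hε
    exact ⟨l, fun m hm n hn => hdist _ (hU.subset hl hm (hw m)) _ (hU.subset hl hn (hw n))⟩
  obtain ⟨x, hx⟩ := cauchySeq_tendsto_of_complete hcauchy
  refine ⟨x, hx, fun k hk => ?_⟩
  obtain ⟨l, hl, hclosure, -⟩ := hU.exists_closure_subset_dist_lt hk one_pos
  refine hclosure (mem_closure_of_tendsto hx ?_)
  filter_upwards [eventually_ge_atTop l] with n hn using hU.subset (hk.trans hl) hn (hw n)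

/-- Close to `z j` there are the points born when a small neighborhood of `z j` splits. -/
theorem IsSplittingScheme.preperfect_range (hU : IsSplittingScheme U) {z : ℕ → Z}
    (hz : ∀ j, ∀ k ≥ j, z j ∈ U k j) : Preperfect (range z) := by
  rw [preperfect_iff_nhds]
  rintro _ ⟨j, rfl⟩ O hO
  obtain ⟨ε, hε, hεO⟩ := Metric.mem_nhds_iff.1 hO
  obtain ⟨l, hl, -, hdist⟩ := hU.exists_closure_subset_dist_lt (le_refl j) hε
  obtain ⟨k, hjk, hlk, rfl⟩ := exists_ge_unpair_fst_eq j l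
  have hnew : z (k + 1) ∈ U (k + 1) (k + 1) := hz _ _ le_rfl
  have hnear : z (k + 1) ∈ U l k.unpair.1 :=
    hU.subset hl hlk ((hU k).closure_new_subset (subset_closure hnew))
  refine ⟨z (k + 1), ⟨hεO (hdist _ hnear _ (hz _ l hl)), mem_range_self _⟩, fun heq => ?_⟩
  exact Set.disjoint_left.1 (hU k).disjoint (hz _ (k + 1) (by omega)) (heq ▸ hnew)

theorem exists_isSplittingScheme_not_isNegligible {X : Type*} [SecondCountableTopology Z]
    [CompleteSpace Z] [MeasurableSpace Z] [BorelSpace Z] [MeasurableSpace X] [MeasurableEq X]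
    {f : Z → X} (hf : Measurable f) (hlarge : ¬ IsNegligible f fun _ => univ) :
    ∃ U : ℕ → ℕ → Set Z, IsSplittingScheme U ∧ ∀ k, ¬ IsNegligible f (U k) := by
  let State := {U : ℕ → Set Z // (∀ j, IsOpen (U j)) ∧ ¬ IsNegligible f U}
  have hstep (k : ℕ) (U : State) :
      ∃ V : State, IsSplitting k.unpair.1 (k + 1) ((1 / 2) ^ k) U.1 V.1 := by
    obtain ⟨V, hVopen, hVlarge, hV⟩ := exists_isSplitting_not_isNegligible hf
      (Nat.lt_succ_of_le (Nat.unpair_left_le k)).ne U.2.1 U.2.2 (pow_pos one_half_pos k)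
    exact ⟨⟨V, hVopen, hVlarge⟩, hV⟩
  choose next hnext using hstep
  let U (k : ℕ) : State := Nat.rec ⟨fun _ => univ, fun _ => isOpen_univ, hlarge⟩ next k
  exact ⟨fun k => (U k).1, fun k => hnext k (U k), fun k => (U k).2.2⟩

end SplittingScheme

section LusinNovikov

theorem not_countable_of_perfect {Z : Type*} [MetricSpace Z] [CompleteSpace Z] {C : Set Z}
    (hC : Perfect C) (hne : C.Nonempty) : ¬ C.Countable := by
  obtain ⟨g, hg, -, hginj⟩ := hC.exists_nat_bool_injection hne
  intro hcount
  have : Countable (ℕ → Bool) := countable_univ_iff.1 <|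
    MapsTo.countable_of_injOn (fun a _ => hg (mem_range_self a)) hginj.injOn hcount
  have huncountable : Cardinal.aleph0 < Cardinal.mk (ℕ → Bool) :=
    (Cardinal.cantor Cardinal.aleph0).trans_eq (by
      rw [← Cardinal.mk_bool, ← Cardinal.mk_nat, Cardinal.power_def])
  exact huncountable.not_ge Cardinal.mk_le_aleph0

variable {Z X : Type*} [MeasurableSpace Z] [MeasurableSpace X] {f : Z → X}

theorem isSigmaInjective_univ_of_continuous [MetricSpace Z] [SecondCountableTopology Z]
    [CompleteSpace Z] [BorelSpace Z] [TopologicalSpace X] [T2Space X] [BorelSpace X]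
    [MeasurableEq X] (hf : Continuous f) (hcount : ∀ x, (f ⁻¹' {x}).Countable) :
    IsSigmaInjective f univ := by
  by_contra hlarge
  obtain ⟨U, hU, hUlarge⟩ := exists_isSplittingScheme_not_isNegligible hf.measurable
    (mt isSigmaInjective_univ_of_isNegligible hlarge)
  have hne (k : ℕ) : (fiberSequences f (U k)).Nonempty :=
    nonempty_iff_ne_empty.2 (mt isNegligible_of_fiberSequences_eq_empty (hUlarge k))
  choose w hwU hwf using hne
  choose z hz hzU using fun j => hU.exists_tendsto_mem fun k => hwU k j
  have hzf (j : ℕ) : f (z j) = f (z 0) := by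
    refine tendsto_nhds_unique ((hf.tendsto _).comp (hz j)) ?_
    convert (hf.tendsto _).comp (hz 0) using 1
    exact funext fun k => hwf k j 0
  refine not_countable_of_perfect (hU.preperfect_range hzU).perfect_closure
    (range_nonempty z).closure ((hcount (f (z 0))).mono ?_)
  exact closure_minimal (range_subset_iff.2 hzf) (isClosed_singleton.preimage hf)

theorem isSigmaInjective_univ_of_measurable [StandardBorelSpace Z] [StandardBorelSpace X]
    (hf : Measurable f) (hcount : ∀ x, (f ⁻¹' {x}).Countable) : IsSigmaInjective f univ := by
  let := upgradeStandardBorel X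
  let := upgradeStandardBorel Z
  have hpolish : PolishSpace Z := inferInstance
  have hborel : ‹MeasurableSpace Z› = borel Z := BorelSpace.measurable_eq
  obtain ⟨t, ht, hft, htpolish⟩ := hf.exists_continuous
  have : @BorelSpace Z t _ :=
    @BorelSpace.mk Z t _ (by rw [borel_eq_borel_of_le htpolish hpolish ht]; exact hborel)
  let := @TopologicalSpace.upgradeIsCompletelyMetrizable Z t inferInstance
  have : SecondCountableTopology Z := htpolish.toSecondCountableTopology
  exact isSigmaInjective_univ_of_continuous hft hcount

theorem exists_measurable_enumeration_of_countable_sections {X Y : Type*} [MeasurableSpace X]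
    [StandardBorelSpace X] [MeasurableSpace Y] [StandardBorelSpace Y] {P : Set (X × Y)}
    (hP : MeasurableSet P) (hcount : ∀ x, {y | (x, y) ∈ P}.Countable) {d : X → Y}
    (hd : Measurable d) (hdP : ∀ x, (x, d x) ∈ P) :
    ∃ g : ℕ → X → Y, (∀ n, Measurable (g n)) ∧ ∀ x y, (x, y) ∈ P ↔ ∃ n, g n x = y := by
  have := hP.standardBorel
  obtain ⟨B, hB, hinj, hcover⟩ := isSigmaInjective_univ_of_measurable
    (f := fun p : P => p.1.1) (measurable_fst.comp measurable_subtype_coe) fun x =>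
      MapsTo.countable_of_injOn (f := fun p : P => p.1.2) (t := {y | (x, y) ∈ P})
        (by rintro p rfl; exact p.2)
        (by rintro p rfl q hq hpq; exact Subtype.ext (Prod.ext hq.symm hpq)) (hcount x)
  have hBsb (n : ℕ) := (hB n).standardBorel
  let e (n : ℕ) (p : B n) : X := p.1.1.1
  have he (n : ℕ) : MeasurableEmbedding (e n) :=
    (measurable_fst.comp (measurable_subtype_coe.comp measurable_subtype_coe)).measurableEmbedding
      (hinj n).injective
  refine ⟨fun n => Function.extend (e n) (fun p => p.1.1.2) d, fun n => ?_, fun x y => ⟨?_, ?_⟩⟩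
  · exact (he n).measurable_extend
      (measurable_snd.comp (measurable_subtype_coe.comp measurable_subtype_coe)) hd
  · intro hxy
    obtain ⟨n, hn⟩ := mem_iUnion.1 (hcover ▸ mem_univ (⟨(x, y), hxy⟩ : P))
    exact ⟨n, (he n).injective.extend_apply _ d ⟨_, hn⟩⟩
  · rintro ⟨n, rfl⟩
    by_cases hx : ∃ p, e n p = x
    · obtain ⟨p, rfl⟩ := hx
      simpa only [(he n).injective.extend_apply] using p.1.2
    · simpa only [Function.extend_apply' _ _ _ hx] using hdP x

theorem IsCountableBorelRel.exists_measurable_enumeration [StandardBorelSpace X] {R : Setoid X}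
    (hR : IsCountableBorelRel R) :
    ∃ g : ℕ → X → X, (∀ n, Measurable (g n)) ∧ ∀ x y, R x y ↔ ∃ n, g n x = y :=
  exists_measurable_enumeration_of_countable_sections hR.borel hR.countable_class measurable_id
    R.refl

end LusinNovikov

section Contraction

variable {V W : Type*} {G : SimpleGraph V} {r : V → W}

theorem reachable_map {u v : V} (huv : G.Reachable u v) : (G.map r).Reachable (r u) (r v) := by
  obtain ⟨p⟩ := huv
  induction p with
  | nil => exact .refl _
  | @cons u v _ hadj _ ih =>
    by_cases hr : r u = r v
    · rwa [hr]
    · exact .trans (SimpleGraph.Adj.reachable ⟨hr, u, v, hadj, rfl, rfl⟩) ih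

theorem reachable_of_reachable_map (hfiber : ∀ u v, r u = r v → G.Reachable u v) {u v : V}
    (huv : (G.map r).Reachable (r u) (r v)) : G.Reachable u v := by
  obtain ⟨p⟩ := huv
  generalize ha : r u = a, hb : r v = b at p
  induction p generalizing u with
  | nil => exact hfiber u v (ha.trans hb.symm)
  | cons hadj _ ih =>
    obtain ⟨-, u', v', hadj', rfl, rfl⟩ := hadj
    exact (hfiber u u' ha).trans (hadj'.reachable.trans (ih rfl hb))

/-- The graph `G` without the edges that join different fibers of `r`. -/
def fiberGraph (G : SimpleGraph V) (r : V → W) : SimpleGraph V where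
  Adj u v := G.Adj u v ∧ r u = r v
  symm := ⟨fun _ _ h => ⟨h.1.symm, h.2.symm⟩⟩
  loopless := ⟨fun _ h => h.1.ne rfl⟩

theorem fiberGraph_le : fiberGraph G r ≤ G :=
  fun _ _ h => h.1

/-- An edge of `G.map r` comes from an edge of `G` between different fibers. Deleting the latter
from `G` leaves the fibers connected, so a path of `G.map r` avoiding the former would lift. -/
theorem isAcyclic_map (hG : G.IsAcyclic)
    (hfiber : ∀ u v, r u = r v → (fiberGraph G r).Reachable u v) : (G.map r).IsAcyclic := by
  rw [SimpleGraph.isAcyclic_iff_forall_adj_isBridge] at hG ⊢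
  rintro _ _ ⟨hne, u, v, huv, rfl, rfl⟩
  have hbridge := hG huv
  rw [SimpleGraph.isBridge_iff] at hbridge ⊢
  have hfiberGraph : fiberGraph G r ≤ G.deleteEdges {s(u, v)} := fun x y hxy => by
    refine SimpleGraph.deleteEdges_adj.2 ⟨hxy.1, fun he => ?_⟩
    rcases Sym2.eq_iff.1 (mem_singleton_iff.1 he) with ⟨rfl, rfl⟩ | ⟨rfl, rfl⟩
    exacts [hne hxy.2, hne hxy.2.symm]
  have hmap : (G.map r).deleteEdges {s(r u, r v)} ≤ (G.deleteEdges {s(u, v)}).map r := by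
    intro a b hab
    obtain ⟨⟨hab, x, y, hxy, rfl, rfl⟩, he⟩ := SimpleGraph.deleteEdges_adj.1 hab
    refine ⟨hab, x, y, SimpleGraph.deleteEdges_adj.2 ⟨hxy, fun hxy' => he ?_⟩, rfl, rfl⟩
    exact mem_singleton_iff.2 (congrArg (Sym2.map r) (mem_singleton_iff.1 hxy'))
  exact fun h => hbridge <| reachable_of_reachable_map
    (fun x y hxy => (hfiber x y hxy).mono hfiberGraph) (h.mono hmap)

end Contraction

section Retraction

variable {V : Type*} {G : SimpleGraph V} {g : ℕ → V → V} {C : Set V} {u : V}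

/-- The distance in `G` from the vertex `u` to the set `C`; it is `⊤` if `C` cannot be reached
from `u`. -/
noncomputable def edistToSet (G : SimpleGraph V) (C : Set V) (u : V) : ℕ∞ :=
  ⨅ c ∈ C, G.edist u c

theorem edistToSet_le_natCast_iff {n : ℕ} :
    edistToSet G C u ≤ n ↔ ∃ c ∈ C, ∃ p : G.Walk u c, p.length ≤ n := by
  constructor
  · contrapose!
    intro h
    have hle : ((n + 1 : ℕ) : ℕ∞) ≤ edistToSet G C u :=
      le_iInf₂ fun c hc => le_iInf fun p => by exact_mod_cast h c hc p
    exact lt_of_lt_of_le (by exact_mod_cast n.lt_succ_self) hle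
  · rintro ⟨c, hc, p, hp⟩
    exact (iInf₂_le c hc).trans (p.edist_le.trans (by exact_mod_cast hp))

theorem edistToSet_le_zero_iff : edistToSet G C u ≤ (0 : ℕ) ↔ u ∈ C := by
  rw [edistToSet_le_natCast_iff]
  constructor
  · rintro ⟨c, hc, p, hp⟩
    rwa [SimpleGraph.Walk.eq_of_length_eq_zero (Nat.le_zero.1 hp)]
  · exact fun hu => ⟨u, hu, .nil, le_rfl⟩

theorem edistToSet_le_succ_iff {n : ℕ} :
    edistToSet G C u ≤ (n + 1 : ℕ) ↔ u ∈ C ∨ ∃ v, G.Adj u v ∧ edistToSet G C v ≤ n := by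
  simp only [edistToSet_le_natCast_iff]
  constructor
  · rintro ⟨c, hc, p, hp⟩
    cases p with
    | nil => exact .inl hc
    | cons huv p => exact .inr ⟨_, huv, c, hc, p, Nat.le_of_succ_le_succ hp⟩
  · rintro (hu | ⟨v, huv, c, hc, p, hp⟩)
    · exact ⟨u, hu, .nil, Nat.zero_le _⟩
    · exact ⟨c, hc, .cons huv p, Nat.succ_le_succ hp⟩

theorem edistToSet_ne_top_of_reachable {c : V} (hc : c ∈ C) (huc : G.Reachable u c) :
    edistToSet G C u ≠ ⊤ :=
  ((iInf₂_le c hc).trans_lt (SimpleGraph.edist_ne_top_iff_reachable.2 huc).lt_top).ne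

open Classical in
/-- One step from `u` towards `C`: to the first `g n u` that is a neighbor of `u` closer to `C`, if
there is one. The map is used when the `g n u` exhaust the neighbors of `u`; choosing the first one
makes it measurable. -/
noncomputable def stepTowards (G : SimpleGraph V) (g : ℕ → V → V) (C : Set V) (u : V) : V :=
  if h : ∃ n, G.Adj u (g n u) ∧ edistToSet G C (g n u) < edistToSet G C u then g (Nat.find h) u
  else u

theorem stepTowards_eq_self_or_adj :
    stepTowards G g C u = u ∨ G.Adj u (stepTowards G g C u) := by
  classical
  unfold stepTowards
  split_ifs with h
  exacts [.inr (Nat.find_spec h).1, .inl rfl]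

theorem stepTowards_of_mem (hu : u ∈ C) : stepTowards G g C u = u := by
  refine dif_neg ?_
  rintro ⟨n, -, hlt⟩
  exact not_lt_bot (hlt.trans_le (edistToSet_le_zero_iff.2 hu))

theorem edistToSet_stepTowards_le (hg : ∀ u v, G.Adj u v → ∃ n, g n u = v) {n : ℕ}
    (hu : edistToSet G C u ≤ (n + 1 : ℕ)) : edistToSet G C (stepTowards G g C u) ≤ n := by
  classical
  by_cases hle : edistToSet G C u ≤ n
  · unfold stepTowards
    split_ifs with h
    exacts [(Nat.find_spec h).2.le.trans hle, hle]
  have hcloser : ∃ m, G.Adj u (g m u) ∧ edistToSet G C (g m u) < edistToSet G C u := by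
    obtain hmem | ⟨v, huv, hv⟩ := edistToSet_le_succ_iff.1 hu
    · exact absurd ((edistToSet_le_zero_iff.2 hmem).trans (by exact_mod_cast n.zero_le)) hle
    · obtain ⟨m, rfl⟩ := hg u v huv
      exact ⟨m, huv, hv.trans_lt (not_le.1 hle)⟩
  rw [stepTowards, dif_pos hcloser]
  refine Order.le_of_lt_add_one ((Nat.find_spec hcloser).2.trans_le ?_)
  exact_mod_cast hu

theorem iterate_stepTowards_mem (hg : ∀ u v, G.Adj u v → ∃ n, g n u = v) {n : ℕ}
    (hu : edistToSet G C u ≤ n) : (stepTowards G g C)^[n] u ∈ C := by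
  induction n generalizing u with
  | zero => exact edistToSet_le_zero_iff.1 hu
  | succ n ih => exact ih (edistToSet_stepTowards_le hg hu)

/-- The point of `C` at which the walk from `u` by steps towards `C` arrives. If `C` cannot be
reached from `u`, the value is `u`, as `⊤.toNat = 0`. -/
noncomputable def retractionOnto (G : SimpleGraph V) (g : ℕ → V → V) (C : Set V) (u : V) : V :=
  (stepTowards G g C)^[(edistToSet G C u).toNat] u

theorem retractionOnto_mem (hg : ∀ u v, G.Adj u v → ∃ n, g n u = v)
    (hu : edistToSet G C u ≠ ⊤) : retractionOnto G g C u ∈ C :=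
  iterate_stepTowards_mem hg (ENat.natCast_toNat hu).ge

theorem retractionOnto_of_mem (hu : u ∈ C) : retractionOnto G g C u = u :=
  Function.iterate_fixed (stepTowards_of_mem hu) _

theorem retractionOnto_of_edistToSet_eq_top (hu : edistToSet G C u = ⊤) :
    retractionOnto G g C u = u := by
  rw [retractionOnto, hu, ENat.toNat_top, Function.iterate_zero_apply]

theorem iterate_stepTowards_eq_retractionOnto (hg : ∀ u v, G.Adj u v → ∃ n, g n u = v) {n : ℕ}
    (hu : edistToSet G C u ≤ n) : (stepTowards G g C)^[n] u = retractionOnto G g C u := by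
  obtain ⟨k, rfl⟩ := Nat.exists_eq_add_of_le' (ENat.toNat_le_of_le_natCast hu)
  have hmem := retractionOnto_mem hg (hu.trans_lt (ENat.natCast_lt_top _)).ne
  rw [Function.iterate_add_apply]
  exact Function.iterate_fixed (stepTowards_of_mem hmem) k

theorem retractionOnto_stepTowards (hg : ∀ u v, G.Adj u v → ∃ n, g n u = v)
    (hu : edistToSet G C u ≠ ⊤) :
    retractionOnto G g C (stepTowards G g C u) = retractionOnto G g C u := by
  obtain ⟨n, hn⟩ := ENat.ne_top_iff_exists.1 hu
  have hle : edistToSet G C u ≤ (n + 1 : ℕ) := hn ▸ by exact_mod_cast n.le_succ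
  rw [← iterate_stepTowards_eq_retractionOnto hg hle,
    ← iterate_stepTowards_eq_retractionOnto hg (edistToSet_stepTowards_le hg hle)]
  rfl

theorem reachable_fiberGraph_retractionOnto_self (hg : ∀ u v, G.Adj u v → ∃ n, g n u = v) (u : V) :
    (fiberGraph G (retractionOnto G g C)).Reachable u (retractionOnto G g C u) := by
  by_cases htop : edistToSet G C u = ⊤
  · rw [retractionOnto_of_edistToSet_eq_top htop]
  obtain ⟨n, hn⟩ := ENat.ne_top_iff_exists.1 htop
  replace hn := hn.ge
  clear htop
  induction n generalizing u with
  | zero => rw [retractionOnto_of_mem (edistToSet_le_zero_iff.1 hn)]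
  | succ n ih =>
    have hstep := retractionOnto_stepTowards hg (hn.trans_lt (ENat.natCast_lt_top _)).ne
    have hih := ih _ (edistToSet_stepTowards_le hg hn)
    rw [hstep] at hih
    obtain heq | hadj := stepTowards_eq_self_or_adj (G := G) (g := g) (C := C) (u := u)
    · rwa [heq] at hih
    · exact .trans (SimpleGraph.Adj.reachable ⟨hadj, hstep.symm⟩) hih

theorem reachable_retractionOnto_self (hg : ∀ u v, G.Adj u v → ∃ n, g n u = v) (u : V) :
    G.Reachable u (retractionOnto G g C u) :=
  (reachable_fiberGraph_retractionOnto_self hg u).mono fiberGraph_le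

theorem mem_of_adj_map_retractionOnto (hg : ∀ u v, G.Adj u v → ∃ n, g n u = v) {c d : V}
    (hcd : (G.map (retractionOnto G g C)).Adj c d) (hc : c ∈ C) : d ∈ C := by
  obtain ⟨-, u, v, huv, rfl, rfl⟩ := hcd
  exact retractionOnto_mem hg <| edistToSet_ne_top_of_reachable hc <|
    huv.symm.reachable.trans (reachable_retractionOnto_self hg u)

theorem isAcyclic_map_retractionOnto (hg : ∀ u v, G.Adj u v → ∃ n, g n u = v) (hG : G.IsAcyclic) :
    (G.map (retractionOnto G g C)).IsAcyclic :=
  isAcyclic_map hG fun u v huv => (reachable_fiberGraph_retractionOnto_self hg u).trans <|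
    huv ▸ (reachable_fiberGraph_retractionOnto_self hg v).symm

end Retraction

section Measurability

theorem measurable_apply_of_countable {ι α β : Type*} [Countable ι] [MeasurableSpace ι]
    [MeasurableSingletonClass ι] [MeasurableSpace α] [MeasurableSpace β] {f : ι → α → β}
    (hf : ∀ k, Measurable (f k)) {n : α → ι} (hn : Measurable n) :
    Measurable fun x => f (n x) x :=
  (measurable_from_prod_countable_right (f := fun q : ι × α => f q.1 q.2) hf).comp
    (hn.prodMk measurable_id)

theorem measurable_dite_find {α β : Type*} [MeasurableSpace α] [MeasurableSpace β]
    {p : α → ℕ → Prop} [∀ x, DecidablePred (p x)] [∀ x, Decidable (∃ n, p x n)]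
    (hp : ∀ n, MeasurableSet {x | p x n}) {f : ℕ → α → β} (hf : ∀ n, Measurable (f n))
    {d : α → β} (hd : Measurable d) :
    Measurable fun x => if h : ∃ n, p x n then f (Nat.find h) x else d x := by
  have hex : MeasurableSet {x | ∃ n, p x n} := by
    rw [ofPred_exists]
    exact .iUnion hp
  refine Measurable.dite (s := {x | ∃ n, p x n}) (f := fun x => f (Nat.find x.2) x)
    (g := fun x => d x) ?_ (hd.comp measurable_subtype_coe) hex
  have hfind : Measurable fun x : {x | ∃ n, p x n} => Nat.find x.2 :=
    measurable_find (fun x => x.2) fun n => measurable_subtype_coe (hp n)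
  exact measurable_apply_of_countable (fun n => (hf n).comp measurable_subtype_coe) hfind

variable {X Y : Type*} [MeasurableSpace X] [MeasurableSpace Y] {G : SimpleGraph X}
  {g : ℕ → X → X} {C : Y → Set X}

theorem measurable_edistToSet (hG : MeasurableSet {p : X × X | G.Adj p.1 p.2})
    (hgm : ∀ n, Measurable (g n)) (hg : ∀ u v, G.Adj u v → ∃ n, g n u = v)
    (hC : MeasurableSet {p : Y × X | p.2 ∈ C p.1}) :
    Measurable fun p : Y × X => edistToSet G (C p.1) p.2 := by
  have hle (n : ℕ) : MeasurableSet {p : Y × X | edistToSet G (C p.1) p.2 ≤ n} := by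
    induction n with
    | zero => simpa only [edistToSet_le_zero_iff] using hC
    | succ n ih =>
      have hsucc : {p : Y × X | edistToSet G (C p.1) p.2 ≤ (n + 1 : ℕ)} =
          {p | p.2 ∈ C p.1} ∪ ⋃ m, {p | G.Adj p.2 (g m p.2)} ∩
            {p | edistToSet G (C p.1) (g m p.2) ≤ n} := by
        ext p
        simp only [mem_union, mem_iUnion, mem_inter_iff, mem_ofPred_eq, edistToSet_le_succ_iff]
        refine or_congr_right ⟨?_, fun ⟨m, h⟩ => ⟨_, h⟩⟩
        rintro ⟨v, huv, hv⟩
        obtain ⟨m, rfl⟩ := hg _ v huv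
        exact ⟨m, huv, hv⟩
      rw [hsucc]
      have hgm' (m : ℕ) : Measurable fun p : Y × X => g m p.2 := (hgm m).comp measurable_snd
      exact hC.union <| .iUnion fun m =>
        (measurable_snd.prodMk (hgm' m) hG).inter (measurable_fst.prodMk (hgm' m) ih)
  refine ENat.measurable_iff.2 fun n => ?_
  cases n with
  | zero => simpa only [preimage, mem_singleton_iff, Nat.cast_zero, nonpos_iff_eq_zero] using hle 0
  | succ n =>
    convert (hle (n + 1)).diff (hle n) using 1
    ext p
    rw [mem_preimage, mem_singleton_iff, Set.mem_sdiff, le_antisymm_iff]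
    refine and_congr_right fun _ => ?_
    rw [mem_ofPred_eq, not_le, ← ENat.add_one_le_iff (ENat.natCast_ne_top n), Nat.cast_add_one]

theorem measurable_stepTowards (hG : MeasurableSet {p : X × X | G.Adj p.1 p.2})
    (hgm : ∀ n, Measurable (g n)) (hg : ∀ u v, G.Adj u v → ∃ n, g n u = v)
    (hC : MeasurableSet {p : Y × X | p.2 ∈ C p.1}) :
    Measurable fun p : Y × X => stepTowards G g (C p.1) p.2 := by
  classical
  have hdist := measurable_edistToSet hG hgm hg hC
  have hgm' (n : ℕ) : Measurable fun p : Y × X => g n p.2 := (hgm n).comp measurable_snd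
  refine measurable_dite_find (fun n => ?_) hgm' measurable_snd
  exact (measurable_snd.prodMk (hgm' n) hG).inter
    ((hdist.comp (measurable_fst.prodMk (hgm' n))).prodMk hdist
      (to_countable {q : ℕ∞ × ℕ∞ | q.1 < q.2}).measurableSet)

theorem measurable_retractionOnto (hG : MeasurableSet {p : X × X | G.Adj p.1 p.2})
    (hgm : ∀ n, Measurable (g n)) (hg : ∀ u v, G.Adj u v → ∃ n, g n u = v)
    (hC : MeasurableSet {p : Y × X | p.2 ∈ C p.1}) :
    Measurable fun p : Y × X => retractionOnto G g (C p.1) p.2 := by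
  have hiterate (n : ℕ) : Measurable fun p : Y × X => (stepTowards G g (C p.1))^[n] p.2 := by
    induction n with
    | zero => exact measurable_snd
    | succ n ih =>
      simp only [Function.iterate_succ_apply']
      exact (measurable_stepTowards hG hgm hg hC).comp (measurable_fst.prodMk ih)
  have htoNat : Measurable fun p : Y × X => (edistToSet G (C p.1) p.2).toNat :=
    (Measurable.of_discrete (f := ENat.toNat)).comp (measurable_edistToSet hG hgm hg hC)
  exact measurable_apply_of_countable hiterate htoNat

end Measurability

section Treeing

variable {X Y : Type*} {G : SimpleGraph X} {R : Setoid X} {S : Setoid Y} {i : Y → X}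
  {g : ℕ → X → X}

theorem IsTreeing.rel_of_reachable [MeasurableSpace X] (hG : IsTreeing R G) {u v : X}
    (huv : G.Reachable u v) : R u v := by
  obtain ⟨p⟩ := huv
  induction p with
  | nil => exact R.refl _
  | cons hadj _ ih => exact R.trans (hG.adj_rel _ _ hadj) ih

theorem IsTreeing.reachable_of_rel [MeasurableSpace X] (hG : IsTreeing R G) {u v : X}
    (huv : R u v) : G.Reachable u v :=
  ((hG.isTree u).connected ⟨u, R.refl u⟩ ⟨v, huv⟩).map (SimpleGraph.Embedding.induce _).toHom

theorem IsTreeing.isAcyclic [MeasurableSpace X] (hG : IsTreeing R G) : G.IsAcyclic := by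
  classical
  intro x c hc
  have hmem : ∀ y ∈ c.support, y ∈ {y | R x y} := fun y hy =>
    hG.rel_of_reachable (c.takeUntil y hy).reachable
  refine (hG.isTree x).isAcyclic (c.induce _ hmem) ?_
  rwa [← SimpleGraph.Walk.isCycle_map_iff_of_injective
    (f := (SimpleGraph.Embedding.induce {y | R x y}).toHom) Subtype.val_injective,
    SimpleGraph.Walk.map_induce]

/-- The image under `i` of the `S`-class of `a`. -/
def classImage (S : Setoid Y) (i : Y → X) (a : Y) : Set X :=
  i '' {b | S a b}

theorem classImage_eq_of_rel {a b : Y} (h : S a b) : classImage S i a = classImage S i b := by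
  refine congrArg (i '' ·) (Set.ext fun c => ⟨fun hc => ?_, fun hc => ?_⟩)
  exacts [S.trans (S.symm h) hc, S.trans h hc]

theorem measurableSet_classImage [MeasurableSpace X] [StandardBorelSpace X] [MeasurableSpace Y]
    [StandardBorelSpace Y] (hS : IsBorelRel S) (hi : Measurable i) (hinj : Function.Injective i) :
    MeasurableSet {p : Y × X | p.2 ∈ classImage S i p.1} := by
  convert hS.image_of_measurable_injOn (f := fun q : Y × Y => (q.1, i q.2))
    (measurable_fst.prodMk (hi.comp measurable_snd)) ?_ using 1
  · ext ⟨a, u⟩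
    simp [classImage]
  · exact (Function.injective_id.prodMap hinj).injOn

/-- The graph on `Y` that results from contracting, for each `S`-class, the graph `G` onto the
image of this class under `i`. -/
def contractedGraph (G : SimpleGraph X) (S : Setoid Y) (i : Y → X) (g : ℕ → X → X) :
    SimpleGraph Y where
  Adj a b := S a b ∧ (G.map (retractionOnto G g (classImage S i a))).Adj (i a) (i b)
  symm := ⟨fun _ _ ⟨hab, hadj⟩ => ⟨S.symm hab, classImage_eq_of_rel hab ▸ hadj.symm⟩⟩
  loopless := ⟨fun _ h => h.2.ne rfl⟩

theorem isAcyclic_induce_contractedGraph (hg : ∀ u v, G.Adj u v → ∃ n, g n u = v)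
    (hG : G.IsAcyclic) (hinj : Function.Injective i) (x : Y) :
    ((contractedGraph G S i g).induce {y | S x y}).IsAcyclic :=
  (isAcyclic_map_retractionOnto (C := classImage S i x) hg hG).comap
    ⟨fun a => i a, fun {a _} hab => classImage_eq_of_rel a.2 ▸ hab.2⟩
    (hinj.comp Subtype.val_injective)

theorem connected_induce_contractedGraph (hg : ∀ u v, G.Adj u v → ∃ n, g n u = v)
    (hinj : Function.Injective i) (hSG : ∀ a b, S a b → G.Reachable (i a) (i b)) (x : Y) :
    ((contractedGraph G S i g).induce {y | S x y}).Connected := by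
  have hmem {a : Y} (ha : S x a) : i a ∈ classImage S i x := mem_image_of_mem i ha
  have lift {u v : X} (p : (G.map (retractionOnto G g (classImage S i x))).Walk u v) {a b : Y}
      (ha : S x a) (hb : S x b) (hau : i a = u) (hbv : i b = v) :
      ((contractedGraph G S i g).induce {y | S x y}).Reachable ⟨a, ha⟩ ⟨b, hb⟩ := by
    induction p generalizing a with
    | nil =>
      obtain rfl := hinj (hau.trans hbv.symm)
      exact .refl _
    | cons hadj _ ih =>
      subst hau
      obtain ⟨c, hc, rfl⟩ := mem_of_adj_map_retractionOnto hg hadj (hmem ha)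
      refine .trans (SimpleGraph.Adj.reachable ⟨S.trans (S.symm ha) hc, ?_⟩) (ih hc rfl hbv)
      exact classImage_eq_of_rel ha ▸ hadj
  have : Nonempty {y | S x y} := ⟨x, S.refl x⟩
  refine .mk fun ⟨a, ha⟩ ⟨b, hb⟩ => ?_
  obtain ⟨p⟩ := reachable_map (r := retractionOnto G g (classImage S i x))
    (hSG a b (S.trans (S.symm ha) hb))
  exact lift p ha hb (retractionOnto_of_mem (hmem ha)).symm (retractionOnto_of_mem (hmem hb)).symm

variable [MeasurableSpace X] [StandardBorelSpace X] [MeasurableSpace Y] [StandardBorelSpace Y]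

theorem measurableSet_contractedGraph_adj (hG : IsTreeing R G) (hgm : ∀ n, Measurable (g n))
    (hgR : ∀ u v, R u v ↔ ∃ n, g n u = v) (hS : IsBorelRel S) (hi : Measurable i)
    (hinj : Function.Injective i) :
    MeasurableSet {p : Y × Y | (contractedGraph G S i g).Adj p.1 p.2} := by
  have hg (u v : X) (huv : G.Adj u v) : ∃ n, g n u = v := (hgR u v).1 (hG.adj_rel u v huv)
  have hgi (n : ℕ) : Measurable fun p : Y × Y => g n (i p.1) :=
    (hgm n).comp (hi.comp measurable_fst)
  have hretraction : Measurable fun q : Y × X => retractionOnto G g (classImage S i q.1) q.2 :=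
    measurable_retractionOnto hG.borel hgm hg (measurableSet_classImage hS hi hinj)
  have hretract (n : ℕ) : Measurable fun p : Y × Y =>
      retractionOnto G g (classImage S i p.1) (g n (i p.1)) := by
    simpa only [Function.comp_def] using hretraction.comp (measurable_fst.prodMk (hgi n))
  have hadj : {p : Y × Y | (contractedGraph G S i g).Adj p.1 p.2} =
      {p | S p.1 p.2} ∩ ({p | i p.1 = i p.2}ᶜ ∩ ⋃ (m) (n),
        {p | G.Adj (g m (i p.1)) (g n (i p.1))} ∩
          ({p | retractionOnto G g (classImage S i p.1) (g m (i p.1)) = i p.1} ∩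
            {p | retractionOnto G g (classImage S i p.1) (g n (i p.1)) = i p.2})) := by
    ext ⟨a, b⟩
    simp only [mem_inter_iff, mem_compl_iff, mem_iUnion, mem_ofPred_eq]
    refine and_congr_right fun _ => and_congr_right fun _ => ⟨?_, fun ⟨m, n, h⟩ => ⟨_, _, h⟩⟩
    rintro ⟨u, v, huv, hu, hv⟩
    have hau : R (i a) u :=
      hG.rel_of_reachable (hu ▸ (reachable_retractionOnto_self hg u).symm)
    obtain ⟨m, rfl⟩ := (hgR _ _).1 hau
    obtain ⟨n, rfl⟩ := (hgR _ _).1 (R.trans hau (hG.adj_rel _ _ huv))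
    exact ⟨m, n, huv, hu, hv⟩
  rw [hadj]
  refine hS.inter (.inter ?_ (.iUnion fun m => .iUnion fun n => .inter ?_ (.inter ?_ ?_)))
  · exact (measurableSet_eq_fun (hi.comp measurable_fst) (hi.comp measurable_snd)).compl
  · exact (hgi m).prodMk (hgi n) hG.borel
  · exact measurableSet_eq_fun (hretract m) (hi.comp measurable_fst)
  · exact measurableSet_eq_fun (hretract n) (hi.comp measurable_snd)

theorem IsTreeable.of_injective (hT : IsTreeable R) (hR : IsCountableBorelRel R)
    (hS : IsBorelRel S) (hi : Measurable i) (hinj : Function.Injective i)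
    (hSR : ∀ a b, S a b → R (i a) (i b)) : IsTreeable S := by
  obtain ⟨G, hG⟩ := hT
  obtain ⟨g, hgm, hgR⟩ := hR.exists_measurable_enumeration
  have hg (u v : X) (huv : G.Adj u v) : ∃ n, g n u = v := (hgR u v).1 (hG.adj_rel u v huv)
  exact ⟨contractedGraph G S i g, {
    borel := measurableSet_contractedGraph_adj hG hgm hgR hS hi hinj
    adj_rel := fun _ _ h => h.1
    isTree := fun x => ⟨connected_induce_contractedGraph hg hinj
        (fun a b hab => hG.reachable_of_rel (hSR a b hab)) x,
      isAcyclic_induce_contractedGraph hg hG.isAcyclic hinj x⟩ }⟩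

end Treeing

/-- Borel subrelations of a treeable countable Borel equivalence relation are treeable: those
defined on all of `X`, and those defined on a Borel subset `A` of `X`. -/
theorem mainTheorem4 {X : Type*} [MeasurableSpace X] [StandardBorelSpace X]
    (R : Setoid X) (hR : IsCountableBorelRel R) (hT : IsTreeable R) :
    (∀ S : Setoid X, IsBorelRel S → (∀ x y : X, S x y → R x y) → IsTreeable S) ∧
    (∀ A : Set X, MeasurableSet A → ∀ S : Setoid A, IsBorelRel S →
      (∀ x y : A, S x y → R x y) → IsTreeable S) := by
  refine ⟨fun S hS hSR => hT.of_injective hR hS measurable_id Function.injective_id hSR,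
    fun A hA S hS hSR => ?_⟩
  have := hA.standardBorel
  exact hT.of_injective hR hS measurable_subtype_coe Subtype.val_injective hSR
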